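/- Let $n,m$ be positive integers and $\delta_0,\dots,\delta_{m-1}\in\mathbb{C}$. **Temperley–Lieb cell modules.** An $(N,p)$-link state consists of $N$ nodes on a line and $p$ pairwise non-crossing arcs joining disjoint pairs of nodes, no unjoined node (defect) being enclosed by an arc. $V_{N,p}$ is the $\mathbb{C}$-vector space with basis the $(N,p)$-link states (the cell module of $\mathsf{TL}_N(\delta)$). For link states $x,y$, reflect $x$ and glue it to $y$; put $\langle x,y\rangle_{N,p,\delta}=\delta^{l}$, with $l$ the number of closed loops, if every defect of $x$ ends up connected to a defect of $y$, and $0$ otherwise. Let $R_{N,p,\delta}=\{x\in V_{N,p}\mid\langle x,y\rangle_{N,p,\delta}=0\ \text{for all } y\}$ be the radical of this bilinear form. **Bubble algebra cell modules.** A bubble diagram is a partition into pairs of $n$ top and $n$ bottom nodes of a rectangle, all nodes being coloured with colours $0,\dots,m-1$, such that paired nodes have the same colour and edges of the same colour do not cross; edges of different colours may cross. A half-diagram is a set of $n$ coloured nodes on a line with arcs joining disjoint pairs of nodes of the same colour, such that for every colour $i$ the nodes and arcs of colour $i$ form a link state. For $\lambda\in\mathbb{Z}_{\ge0}^m$, the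 cell module $\Delta_n(\lambda)$ of the bubble algebra $\mathbb{T}_{n,m}(\delta_0,\dots,\delta_{m-1})$ has as basis the half-diagrams with exactly $\lambda_i$ defects of colour $i$ for each $i$. A bubble diagram $d$ acts on a half-diagram $x$ by putting $d$ above $x$ and replacing every closed loop of colour $i$ by the factor $\delta_i$; the result is $0$ if the colours of the bottom row of $d$ and of $x$ differ or if the number of defects of some colour drops. The bilinear form on $\Delta_n(\lambda)$ is given on half-diagrams $x,y$ by $\langle x,y\rangle=\prod_i\delta_i^{l_i}$, where $l_i$ is the number of closed loops of colour $i$ obtained by reflecting $x$ and gluing it to $y$, if $x,y$ have the same distribution of colours and every defect of $x$ ends up connected to a defect of $y$, and $\langle x,y\rangle=0$ otherwise. The radical of the cell module is $\operatorname{Rad}(\Delta_n(\lambda))=\{x\mid\langle x,y\rangle=0\text{ for all }y\in\Delta_n(\lambda)\}$. Let $\Gamma_{(l,m)}=\{u\in\mathbb{Z}_{\ge0}^m\mid\sum_i u_i=l\}$, and let $\widehat{\mathfrak S}_{n,m}$ be the set of bubble diagrams all of whose $n$ top nodes are joined to bottom nodes. Let $\lambda\in\Gamma_{(n-2v,m)}$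 for some integer $v\ge0$. For $u\in\Gamma_{(v,m)}$, the space $\bigotimes_i V_{\lambda_i+2u_i,u_i}$ is mapped into $\Delta_n(\lambda)$ by drawing the link states side by side from left to right, the $i$-th one in colour $i$; tensor products of subspaces of the $V_{\lambda_i+2u_i,u_i}$ below stand for their images under this map. **Theorem.** (a) For $\lambda\in\Gamma_{(n-2v,m)}$, $$\operatorname{Rad}(\Delta_n(\lambda))=\sum_{u\in\Gamma_{(v,m)}}\ \sum_{\sigma\in\widehat{\mathfrak S}_{n,m}}\sigma\Big(\sum_{i=0}^{m-1}V_{\lambda_0+2u_0,u_0}\otimes\cdots\otimes R_{\lambda_i+2u_i,u_i,\delta_i}\otimes\cdots\otimes V_{\lambda_{m-1}+2u_{m-1},u_{m-1}}\Big).$$ (b) For $m=2$ and $\lambda\in\Gamma_{(n-2v,2)}$, moreover, as a vector space, $$\operatorname{Rad}(\Delta_n(\lambda))\cong\bigoplus_{u\in\Gamma_{(v,2)}}\ \bigoplus^{n_{\lambda+2u}}\big(R_{\lambda_0+2u_0,u_0,\delta_0}\otimes V_{\lambda_1+2u_1,u_1}+V_{\lambda_0+2u_0,u_0}\otimes R_{\lambda_1+2u_1,u_1,\delta_1}\big),$$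 where $n_\mu=\dfrac{n!}{\mu_0!\,\mu_1!}$ for $\mu\in\Gamma_{(n,2)}$. -/

import Mathlib

open scoped DirectSum

noncomputable section

namespace Bubble

/-- A coloured link state on the nodes `ι`, with colours in `κ`: every node has a colour and is
either joined by an arc to another node of its colour, or is a defect (a fixed point of `mate`).
Arcs of the same colour do not cross, and a defect is not enclosed by an arc of its own colour;
there is no condition on parts of different colours. -/
@[ext]
structure LinkState (ι κ : Type) [LinearOrder ι] where
  colour : ι → κ
  mate : ι → ι
  mate_mate : ∀ a, mate (mate a) = a
  colour_mate : ∀ a, colour (mate a) = colour a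
  noncrossing : ∀ a b, colour a = colour b → ¬ (a < b ∧ b < mate a ∧ mate a < mate b)
  exposed : ∀ a b, colour a = colour b → mate b = b → ¬ (a < b ∧ b < mate a)

section Form

variable {ι κ : Type} [LinearOrder ι]

/-- The number of arcs. -/
def LinkState.arcs (x : LinkState ι κ) : ℕ := {a : ι | a < x.mate a}.ncard

/-- The number of defects of colour `i`. -/
def LinkState.defects (x : LinkState ι κ) (i : κ) : ℕ :=
  {a : ι | x.colour a = i ∧ x.mate a = a}.ncard

/-- Connectedness of nodes in the picture in which `x` is reflected and glued to `y`. -/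
def glue (x y : LinkState ι κ) : Setoid ι :=
  Relation.EqvGen.setoid fun a b => b = x.mate a ∨ b = y.mate a

/-- The number of closed loops of colour `i` in that picture: the components of colour `i` that
contain no defect. -/
def loops (x y : LinkState ι κ) (i : κ) : ℕ :=
  {C : Quotient (glue x y) | ∀ a, Quotient.mk (glue x y) a = C →
    x.colour a = i ∧ x.mate a ≠ a ∧ y.mate a ≠ a}.ncard

open Classical in
/-- The pairing of two link states: it is non-zero only if the colours of the nodes agree and every
defect of `x` ends up connected to a defect of `y`, and every loop of colour `i` contributes a
factor `δ i`. -/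
def pairing [Fintype κ] (δ : κ → ℂ) (x y : LinkState ι κ) : ℂ :=
  if x.colour = y.colour ∧
      ∀ a, x.mate a = a → ∃ b, y.mate b = b ∧ (glue x y) a b then
    ∏ i, δ i ^ loops x y i
  else 0

/-- The bilinear form on a vector space whose basis is a family of link states. -/
def form [Fintype κ] {S : Type} (toState : S → LinkState ι κ) (δ : κ → ℂ) :
    LinearMap.BilinForm ℂ (S →₀ ℂ) :=
  Finsupp.linearCombination ℂ fun x : S =>
    Finsupp.linearCombination ℂ fun y : S => pairing δ (toState x) (toState y)

/-- The radical of a bilinear form: all `x` with `B x y = 0` for every `y`. -/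
def formRadical {M : Type} [AddCommGroup M] [Module ℂ M] (B : LinearMap.BilinForm ℂ M) :
    Submodule ℂ M where
  carrier := {x | ∀ y, B x y = 0}
  add_mem' := fun {a b} ha hb y => by simp [ha y, hb y]
  zero_mem' := fun y => by simp
  smul_mem' := fun c x hx y => by simp [hx y]

end Form

/-! ### The Temperley-Lieb algebra (one colour) -/

/-- The `(n, p)`-link states. -/
abbrev TLState (n p : ℕ) : Type := {x : LinkState (Fin n) Unit // x.arcs = p}

/-- The cell module `V_{n,p}` of the Temperley-Lieb algebra. -/
abbrev TLCell (n p : ℕ) : Type := TLState n p →₀ ℂ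

/-- The radical `R_{n,p,δ}` of the bilinear form on `V_{n,p}`. -/
def tlRadical (n p : ℕ) (δ : ℂ) : Submodule ℂ (TLCell n p) :=
  formRadical (form (fun x : TLState n p => x.1) fun _ => δ)

/-! ### The bubble algebra -/

/-- The nodes of a diagram: the top row from left to right followed by the bottom row from right
to left, which is the cyclic order of the nodes along the frame. -/
abbrev Node (n : ℕ) : Type := Fin n ⊕ₗ (Fin n)ᵒᵈ

/-- The `i`-th node of the top row. -/
def top {n : ℕ} (i : Fin n) : Node n := Sum.inlₗ i

/-- The `i`-th node of the bottom row. -/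
def bot {n : ℕ} (i : Fin n) : Node n := Sum.inrₗ (OrderDual.toDual i)

/-- The bubble diagrams on `2n` nodes with `m` colours: all nodes are joined in pairs of the same
colour, and edges of the same colour do not cross. -/
abbrev Diagram (n m : ℕ) : Type := {d : LinkState (Node n) (Fin m) // ∀ a, d.mate a ≠ a}

/-- The diagrams with propagating number `n`. -/
def Diagram.IsPermutation {n m : ℕ} (d : Diagram n m) : Prop :=
  ∀ i, ∃ j, d.1.mate (top i) = bot j

/-- The half-diagrams with `wt i` defects of colour `i`. -/
abbrev HalfDiagram (n : ℕ) {m : ℕ} (wt : Fin m → ℕ) : Type :=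
  {x : LinkState (Fin n) (Fin m) // ∀ i, x.defects i = wt i}

/-- The cell module `Δ_n(wt)` of the bubble algebra. -/
abbrev Cell (n : ℕ) {m : ℕ} (wt : Fin m → ℕ) : Type := HalfDiagram n wt →₀ ℂ

/-- The bilinear form on the cell module. -/
def cellForm (n : ℕ) {m : ℕ} (wt : Fin m → ℕ) (δ : Fin m → ℂ) :
    LinearMap.BilinForm ℂ (Cell n wt) :=
  form (fun x : HalfDiagram n wt => x.1) δ

/-- The radical of the cell module. -/
def cellRadical (n : ℕ) {m : ℕ} (wt : Fin m → ℕ) (δ : Fin m → ℂ) : Submodule ℂ (Cell n wt) :=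
  formRadical (cellForm n wt δ)

section Action

variable {n m : ℕ} {wt : Fin m → ℕ}

/-- Connectedness in the picture in which the diagram `d` is put above the half-diagram `x`, the
bottom row of `d` being identified with the nodes of `x`. -/
def stack (d : Diagram n m) (x : LinkState (Fin n) (Fin m)) : Setoid (Node n) :=
  Relation.EqvGen.setoid fun a b =>
    b = d.1.mate a ∨ ∃ k, a = bot k ∧ b = bot (x.mate k)

/-- The number of closed loops of colour `i` in that picture: the components of colour `i` that
meet neither the top row nor a defect of `x`. -/
def stackLoops (d : Diagram n m) (x : LinkState (Fin n) (Fin m)) (i : Fin m) : ℕ :=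
  {C : Quotient (stack d x) | ∀ a, Quotient.mk (stack d x) a = C →
    d.1.colour a = i ∧ ∃ k, a = bot k ∧ x.mate k ≠ k}.ncard

/-- The colours of the bottom row of `d` are those of `x`, and `y` is the half-diagram that is left
on the top row after `d` has been put above `x`. There is at most one such `y`. -/
def IsComposite (d : Diagram n m) (x y : LinkState (Fin n) (Fin m)) : Prop :=
  (∀ k, d.1.colour (bot k) = x.colour k) ∧
  (∀ i, y.colour i = d.1.colour (top i)) ∧
  ∀ i j, (stack d x) (top i) (top j) ↔ j = i ∨ j = y.mate i

open Classical in
/-- The action of a diagram on the cell module: concatenation with loop replacement. It is zero if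
the colours do not match or if the number of defects of some colour drops. -/
def act (δ : Fin m → ℂ) (d : Diagram n m) : Cell n wt →ₗ[ℂ] Cell n wt :=
  Finsupp.linearCombination ℂ fun x : HalfDiagram n wt =>
    if h : ∃ y : HalfDiagram n wt, IsComposite d x.1 y.1 then
      Finsupp.single h.choose (∏ i, δ i ^ stackLoops d x.1 i)
    else 0

end Action

/-! ### Tensor products of Temperley-Lieb cell modules inside the cell module -/

section Juxtaposition

variable {n m : ℕ}

/-- The position of the `a`-th node of colour `i` when there are `μ j` nodes of each colour `j` and
the nodes are arranged by colour. -/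
def position {μ : Fin m → ℕ} (h : ∑ i, μ i = n) : (Σ i, Fin (μ i)) ≃ Fin n :=
  finSigmaFinEquiv.trans (finCongr h)

theorem position_lt {μ : Fin m → ℕ} (h : ∑ i, μ i = n) (i : Fin m) (a b : Fin (μ i)) :
    position h ⟨i, a⟩ < position h ⟨i, b⟩ ↔ a < b := by
  rw [Fin.lt_def, Fin.lt_def]
  simp [position, finSigmaFinEquiv_apply]

theorem position_surj {μ : Fin m → ℕ} (h : ∑ i, μ i = n) (a : Fin n) :
    ∃ i b, a = position h ⟨i, b⟩ :=
  ⟨_, _, ((position h).apply_symm_apply a).symm⟩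

/-- The map that applies the `i`-th function to the `i`-th block. -/
def blockMap {μ : Fin m → ℕ} (f : ∀ i, Fin (μ i) → Fin (μ i)) (p : Σ i, Fin (μ i)) :
    Σ i, Fin (μ i) :=
  ⟨p.1, f p.1 p.2⟩

@[simp]
theorem blockMap_mk {μ : Fin m → ℕ} (f : ∀ i, Fin (μ i) → Fin (μ i)) (i : Fin m)
    (a : Fin (μ i)) : blockMap f ⟨i, a⟩ = ⟨i, f i a⟩ := rfl

/-- The link states `s 0`, …, `s (m - 1)` drawn side by side, `s i` in colour `i`. -/
def juxtState {μ : Fin m → ℕ} (h : ∑ i, μ i = n) (s : ∀ i, LinkState (Fin (μ i)) Unit) :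
    LinkState (Fin n) (Fin m) where
  colour a := ((position h).symm a).1
  mate a := position h (blockMap (fun i => (s i).mate) ((position h).symm a))
  mate_mate a := by
    obtain ⟨i, b, rfl⟩ := position_surj h a
    simp [(s i).mate_mate]
  colour_mate a := by
    obtain ⟨i, b, rfl⟩ := position_surj h a
    simp
  noncrossing a b := by
    obtain ⟨i, a, rfl⟩ := position_surj h a
    obtain ⟨j, b, rfl⟩ := position_surj h b
    simp only [Equiv.symm_apply_apply, blockMap_mk]
    rintro rfl
    simpa only [position_lt] using (s i).noncrossing a b rfl
  exposed a b := by
    obtain ⟨i, a, rfl⟩ := position_surj h a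
    obtain ⟨j, b, rfl⟩ := position_surj h b
    simp only [Equiv.symm_apply_apply, blockMap_mk]
    rintro rfl hb
    have hb' : (s i).mate b = b := by simpa using hb
    simpa only [position_lt] using (s i).exposed a b rfl hb'

theorem arcs_defects {N : ℕ} (x : LinkState (Fin N) Unit) :
    {a : Fin N | x.mate a = a}.ncard + 2 * x.arcs = N := by
  classical
  have e1 : {a : Fin N | x.mate a < a}.ncard = x.arcs := by
    have : {a : Fin N | x.mate a < a} = x.mate '' {a : Fin N | a < x.mate a} := by
      ext a
      constructor
      · intro ha
        exact ⟨x.mate a, by simpa [x.mate_mate] using ha, x.mate_mate a⟩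
      · rintro ⟨b, hb, rfl⟩
        simpa [x.mate_mate] using hb
    rw [this, Set.ncard_image_of_injective _ (Function.LeftInverse.injective x.mate_mate)]
    rfl
  have e2 : (Set.univ : Set (Fin N)) =
      {a | x.mate a = a} ∪ ({a | a < x.mate a} ∪ {a | x.mate a < a}) := by
    ext a
    simp only [Set.mem_univ, Set.mem_union, Set.mem_ofPred_eq, true_iff]
    rcases lt_trichotomy a (x.mate a) with h | h | h
    · exact Or.inr (Or.inl h)
    · exact Or.inl h.symm
    · exact Or.inr (Or.inr h)
  have e3 : (Set.univ : Set (Fin N)).ncard = N := by simp [Set.ncard_univ]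
  rw [e2, Set.ncard_union_eq, Set.ncard_union_eq, e1] at e3
  · have : {a : Fin N | a < x.mate a}.ncard = x.arcs := rfl
    omega
  · rw [Set.disjoint_left]
    intro a (ha : a < x.mate a) (hb : x.mate a < a)
    exact lt_asymm ha hb
  · rw [Set.disjoint_left]
    rintro a (ha : x.mate a = a) (hb | hb)
    · exact absurd ha (ne_of_gt hb)
    · exact absurd ha (ne_of_lt hb)

theorem juxtState_defects {μ : Fin m → ℕ} (h : ∑ i, μ i = n)
    (s : ∀ i, LinkState (Fin (μ i)) Unit) (i : Fin m) :
    (juxtState h s).defects i = {a : Fin (μ i) | (s i).mate a = a}.ncard := by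
  have hinj : Function.Injective fun a : Fin (μ i) => position h ⟨i, a⟩ := fun a b hab => by
    simpa using hab
  rw [← Set.ncard_image_of_injective _ hinj, LinkState.defects]
  congr 1
  ext a
  constructor
  · obtain ⟨j, a, rfl⟩ := position_surj h a
    rintro ⟨h1, h2⟩
    obtain rfl : j = i := by simpa [juxtState] using h1
    exact ⟨a, by simpa [juxtState] using h2, rfl⟩
  · rintro ⟨b, hb, rfl⟩
    have hb' : (s i).mate b = b := hb
    simp [juxtState, hb']

/-- The set `Γ_{(l,m)}` of `m`-tuples of natural numbers with sum `l`. -/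
abbrev Gam (l m : ℕ) : Type := {u : Fin m → ℕ // ∑ i, u i = l}

variable {v : ℕ} {wt : Fin m → ℕ}

theorem sum_add_two_mul (hwt : ∑ i, wt i + 2 * v = n) (u : Gam v m) :
    ∑ i, (wt i + 2 * u.1 i) = n := by
  rw [Finset.sum_add_distrib, ← Finset.mul_sum, u.2, hwt]

/-- Side-by-side drawing, as a half-diagram. -/
def juxt (hwt : ∑ i, wt i + 2 * v = n) (u : Gam v m)
    (s : ∀ i, TLState (wt i + 2 * u.1 i) (u.1 i)) : HalfDiagram n wt :=
  ⟨juxtState (sum_add_two_mul hwt u) fun i => (s i).1, fun i => by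
    rw [juxtState_defects]
    have h1 := arcs_defects (s i).1
    rw [(s i).2] at h1
    omega⟩

instance {ι κ : Type} [LinearOrder ι] [Finite ι] [Finite κ] : Finite (LinkState ι κ) :=
  Finite.of_injective (fun x => (x.colour, x.mate)) fun x y h => by
    simp only [Prod.mk.injEq] at h
    exact LinkState.ext h.1 h.2

instance (n p : ℕ) : Fintype (TLState n p) := Fintype.ofFinite _

open scoped TensorProduct in
/-- The linear map that sends a pure tensor of link states to their side-by-side drawing. -/
def tensorToCell (hwt : ∑ i, wt i + 2 * v = n) (u : Gam v m) :
    (⨂[ℂ] i, TLCell (wt i + 2 * u.1 i) (u.1 i)) →ₗ[ℂ] Cell n wt :=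
  PiTensorProduct.lift
    (∑ s : ∀ i, TLState (wt i + 2 * u.1 i) (u.1 i),
      ((MultilinearMap.mkPiAlgebra ℂ (Fin m) ℂ).compLinearMap fun i =>
        Finsupp.lapply (s i)).smulRight (Finsupp.single (juxt hwt u s) 1))

/-- The image of `V ⊗ ⋯ ⊗ R_i ⊗ ⋯ ⊗ V` in the cell module, where `V` stands for the
Temperley-Lieb cell modules `V_{wt j + 2 u j, u j}`, and the `i`-th factor is replaced by its
radical. -/
def radicalFactor (δ : Fin m → ℂ) (hwt : ∑ i, wt i + 2 * v = n) (u : Gam v m) (i : Fin m) :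
    Submodule ℂ (Cell n wt) :=
  (LinearMap.range (PiTensorProduct.map fun j =>
    (if j = i then tlRadical (wt j + 2 * u.1 j) (u.1 j) (δ j) else ⊤ :
      Submodule ℂ (TLCell (wt j + 2 * u.1 j) (u.1 j))).subtype)).map (tensorToCell hwt u)

end Juxtaposition

end Bubble

end

/-! Group the half-diagrams by the colouring of their nodes. Different colourings are orthogonal, so
the Gram matrix of the cell module is block diagonal. For a fixed colouring with `wt i + 2 * u i`
nodes of colour `i`, nothing relates arcs of different colours: a half-diagram is a tuple of
ordinary link states, one on each colour class, and gluing never leaves a class. Hence a block is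
the tensor product of Temperley–Lieb Gram matrices (`pairing_state`), and the radical is the direct
sum over all colourings of the kernels of these products (`mem_cellRadical_iff`,
`cellRadicalEquiv`).

The kernel of a tensor product of matrices is the sum of the spaces `V ⊗ ⋯ ⊗ ker ⊗ ⋯ ⊗ V`
(`toTensor_mem`, `prod_mem_productRadical`). For the colouring in consecutive blocks this is the
inner sum of the theorem (`iSup_radicalFactor`).

A permutation diagram either kills a half-diagram or moves its colour classes rigidly to other
positions, and every colouring is reached from the block colouring by some `transition`. This gives
(a). For (b), all colourings with the same `u` contribute isomorphic summands, and `card_colourings`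
counts them. -/

noncomputable section

namespace Bubble

/-! ### Half-diagrams of a fixed colouring as tuples of link states -/

section Sorting

variable {n m : ℕ} {μ : Fin m → ℕ}

/-- An arrangement of `n` nodes into `m` rows of lengths `μ i` that keeps the order of the nodes
in each row. -/
structure Sorting (n : ℕ) {m : ℕ} (μ : Fin m → ℕ) where
  toEquiv : Fin n ≃ Σ i, Fin (μ i)
  lt_iff : ∀ i a b, toEquiv.symm ⟨i, a⟩ < toEquiv.symm ⟨i, b⟩ ↔ a < b

/-- The arrangement of the nodes in consecutive blocks. -/
def blockSorting (h : ∑ i, μ i = n) : Sorting n μ :=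
  ⟨(position h).symm, fun i a b => position_lt h i a b⟩

/-- The node in place `a` of row `i`. -/
def Sorting.node (e : Sorting n μ) (i : Fin m) (a : Fin (μ i)) : Fin n := e.toEquiv.symm ⟨i, a⟩

theorem Sorting.exists_node (e : Sorting n μ) (a : Fin n) : ∃ i b, a = e.node i b :=
  ⟨_, _, (e.toEquiv.symm_apply_apply a).symm⟩

theorem Sorting.node_inj (e : Sorting n μ) {i : Fin m} {a b : Fin (μ i)} :
    e.node i a = e.node i b ↔ a = b := by
  simp [node]

theorem Sorting.node_lt (e : Sorting n μ) {i : Fin m} {a b : Fin (μ i)} :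
    e.node i a < e.node i b ↔ a < b := e.lt_iff i a b

@[simp]
theorem Sorting.toEquiv_node (e : Sorting n μ) (i : Fin m) (a : Fin (μ i)) :
    e.toEquiv (e.node i a) = ⟨i, a⟩ := by
  simp [node]

/-- The link states `s i` drawn on the nodes of row `i` in colour `i`. -/
def Sorting.state (e : Sorting n μ) (s : ∀ i, LinkState (Fin (μ i)) Unit) :
    LinkState (Fin n) (Fin m) where
  colour a := (e.toEquiv a).1
  mate a := e.toEquiv.symm (blockMap (fun i => (s i).mate) (e.toEquiv a))
  mate_mate a := by
    obtain ⟨i, b, rfl⟩ := e.exists_node a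
    simp [(s i).mate_mate, Sorting.node]
  colour_mate a := by
    obtain ⟨i, b, rfl⟩ := e.exists_node a
    simp
  noncrossing a b := by
    obtain ⟨i, a, rfl⟩ := e.exists_node a
    obtain ⟨j, b, rfl⟩ := e.exists_node b
    simp only [Sorting.toEquiv_node, blockMap_mk]
    rintro rfl
    simpa only [Sorting.node, e.lt_iff] using (s i).noncrossing a b rfl
  exposed a b := by
    obtain ⟨i, a, rfl⟩ := e.exists_node a
    obtain ⟨j, b, rfl⟩ := e.exists_node b
    simp only [Sorting.toEquiv_node, blockMap_mk]
    rintro rfl hb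
    have hb' : (s i).mate b = b := by simpa [Sorting.node] using hb
    simpa only [Sorting.node, e.lt_iff] using (s i).exposed a b rfl hb'

@[simp]
theorem Sorting.state_colour_node (e : Sorting n μ) (s : ∀ i, LinkState (Fin (μ i)) Unit)
    (i : Fin m) (a : Fin (μ i)) : (e.state s).colour (e.node i a) = i := by
  simp [state]

@[simp]
theorem Sorting.state_mate_node (e : Sorting n μ) (s : ∀ i, LinkState (Fin (μ i)) Unit)
    (i : Fin m) (a : Fin (μ i)) : (e.state s).mate (e.node i a) = e.node i ((s i).mate a) := by
  simp [state, node]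

theorem Sorting.state_injective (e : Sorting n μ) :
    Function.Injective (e.state : (∀ i, LinkState (Fin (μ i)) Unit) → _) := by
  intro s t h
  funext i
  refine LinkState.ext (funext fun _ => rfl) (funext fun a => ?_)
  have := congrArg (fun x => x.mate (e.node i a)) h
  simpa only [state_mate_node, e.node_inj] using this

theorem Sorting.state_defects (e : Sorting n μ) (s : ∀ i, LinkState (Fin (μ i)) Unit)
    (i : Fin m) : (e.state s).defects i = {a : Fin (μ i) | (s i).mate a = a}.ncard := by
  have hinj : Function.Injective (e.node i) := fun a b hab => e.node_inj.1 hab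
  rw [← Set.ncard_image_of_injective _ hinj, LinkState.defects]
  congr 1
  ext a
  constructor
  · obtain ⟨j, a, rfl⟩ := e.exists_node a
    rintro ⟨h1, h2⟩
    obtain rfl : j = i := by simpa using h1
    exact ⟨a, by simpa [e.node_inj] using h2, rfl⟩
  · rintro ⟨b, hb, rfl⟩
    have hb' : (s i).mate b = b := hb
    simp [hb']

/-- The place of the partner of a node of row `i` in a link state coloured by the rows. -/
theorem Sorting.exists_mate (e : Sorting n μ) (x : LinkState (Fin n) (Fin m))
    (hx : ∀ i a, x.colour (e.node i a) = i) (i : Fin m) (a : Fin (μ i)) :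
    ∃ b, x.mate (e.node i a) = e.node i b := by
  obtain ⟨j, b, h⟩ := e.exists_node (x.mate (e.node i a))
  have h1 := x.colour_mate (e.node i a)
  rw [h, hx, hx] at h1
  subst h1
  exact ⟨b, h⟩

/-- Partners share a colour, so `mate` preserves the rows; since `e.node i` preserves and reflects
order, the planarity conditions restrict to each row. -/
theorem Sorting.exists_state (e : Sorting n μ) (x : LinkState (Fin n) (Fin m))
    (hx : ∀ a, x.colour a = (e.toEquiv a).1) : ∃ s, x = e.state s := by
  have hx' : ∀ i a, x.colour (e.node i a) = i := fun i a => by rw [hx, e.toEquiv_node]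
  choose f hf using e.exists_mate x hx'
  refine ⟨fun i => ⟨fun _ => (), f i, fun a => ?_, fun _ => rfl, fun a b _ => ?_, fun a b _ hb => ?_⟩,
    ?_⟩
  · rw [← e.node_inj, ← hf, ← hf, x.mate_mate]
  · have := x.noncrossing (e.node i a) (e.node i b) (by rw [hx', hx'])
    simpa only [hf, e.node_lt] using this
  · have := x.exposed (e.node i a) (e.node i b) (by rw [hx', hx']) (by rw [hf, hb])
    simpa only [hf, e.node_lt] using this
  · ext a
    · exact congrArg _ (hx a)
    · obtain ⟨i, a, rfl⟩ := e.exists_node a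
      simp [hf]

/-- The nodes sorted by their colours. -/
def colourSorting (c : Fin n → Fin m) (hc : ∀ i, Fintype.card {a // c a = i} = μ i) :
    Sorting n μ where
  toEquiv := (Equiv.sigmaFiberEquiv c).symm.trans
    (Equiv.sigmaCongrRight fun i => (Fintype.orderIsoFinOfCardEq _ (hc i)).symm.toEquiv)
  lt_iff i a b := by
    exact (Fintype.orderIsoFinOfCardEq {a // c a = i} (hc i)).lt_iff_lt

end Sorting

/-! ### Factorisation of the pairing over the colours -/

section Pairing

variable {n m : ℕ} {μ : Fin m → ℕ}

theorem glue_mate_left {ι κ : Type} [LinearOrder ι] (x y : LinkState ι κ) (a : ι) :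
    glue x y a (x.mate a) := Relation.EqvGen.rel _ _ (Or.inl rfl)

theorem glue_mate_right {ι κ : Type} [LinearOrder ι] (x y : LinkState ι κ) (a : ι) :
    glue x y a (y.mate a) := Relation.EqvGen.rel _ _ (Or.inr rfl)

theorem glue_le {ι κ : Type} [LinearOrder ι] {x y : LinkState ι κ} {r : Setoid ι}
    (h1 : ∀ a, r a (x.mate a)) (h2 : ∀ a, r a (y.mate a)) : glue x y ≤ r := by
  refine Setoid.eqvGen_le ?_
  rintro a b (rfl | rfl)
  exacts [h1 a, h2 a]

/-- Connectedness within the rows. -/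
def rowGlue (e : Sorting n μ) (s t : ∀ i, LinkState (Fin (μ i)) Unit) : Setoid (Fin n) where
  r a b := ∃ i a' b', a = e.node i a' ∧ b = e.node i b' ∧ glue (s i) (t i) a' b'
  iseqv :=
    { refl := fun a => by
        obtain ⟨i, a, rfl⟩ := e.exists_node a
        exact ⟨i, a, a, rfl, rfl, (glue _ _).refl a⟩
      symm := by
        rintro a b ⟨i, a', b', ha, hb, h⟩
        exact ⟨i, b', a', hb, ha, (glue _ _).symm h⟩
      trans := by
        rintro a b c ⟨i, a', b', rfl, rfl, h⟩ ⟨j, b'', c', hb, rfl, h'⟩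
        have hb1 := congrArg e.toEquiv hb
        rw [e.toEquiv_node, e.toEquiv_node] at hb1
        obtain ⟨rfl, hb2⟩ := Sigma.mk.inj_iff.1 hb1
        obtain rfl := eq_of_heq hb2
        exact ⟨i, a', c', rfl, rfl, (glue _ _).trans h h'⟩ }

/-- Both inclusions are checked on generating edges, the second after pulling the glued relation
back along `e.node i`. -/
theorem glue_state (e : Sorting n μ) (s t : ∀ i, LinkState (Fin (μ i)) Unit) :
    glue (e.state s) (e.state t) = rowGlue e s t := by
  apply le_antisymm
  · refine glue_le (fun a => ?_) fun a => ?_ <;> obtain ⟨i, a, rfl⟩ := e.exists_node a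
    · exact ⟨i, a, _, rfl, e.state_mate_node s i a, glue_mate_left _ _ _⟩
    · exact ⟨i, a, _, rfl, e.state_mate_node t i a, glue_mate_right _ _ _⟩
  · rintro a b ⟨i, a, b, rfl, rfl, h⟩
    have : glue (s i) (t i) ≤ (glue (e.state s) (e.state t)).comap (e.node i) := by
      refine glue_le (fun a => ?_) fun a => ?_ <;> rw [Setoid.comap_rel]
      · rw [← e.state_mate_node s]
        exact glue_mate_left _ _ _
      · rw [← e.state_mate_node t]
        exact glue_mate_right _ _ _
    exact this h

theorem rowGlue_node (e : Sorting n μ) (s t : ∀ i, LinkState (Fin (μ i)) Unit) {i : Fin m}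
    {a b : Fin (μ i)} : rowGlue e s t (e.node i a) (e.node i b) ↔ glue (s i) (t i) a b := by
  constructor
  · rintro ⟨j, a', b', ha, hb, h⟩
    have ha1 := congrArg e.toEquiv ha
    have hb1 := congrArg e.toEquiv hb
    rw [e.toEquiv_node, e.toEquiv_node] at ha1 hb1
    obtain ⟨rfl, ha2⟩ := Sigma.mk.inj_iff.1 ha1
    obtain rfl := eq_of_heq ha2
    obtain rfl := eq_of_heq (Sigma.mk.inj_iff.1 hb1).2
    exact h
  · exact fun h => ⟨i, a, b, rfl, rfl, h⟩

theorem rowGlue_node_left (e : Sorting n μ) (s t : ∀ i, LinkState (Fin (μ i)) Unit) {i : Fin m}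
    {a : Fin (μ i)} {b : Fin n} (h : rowGlue e s t (e.node i a) b) : ∃ b', b = e.node i b' := by
  obtain ⟨j, a', b', ha, rfl, -⟩ := h
  have ha1 := congrArg e.toEquiv ha
  rw [e.toEquiv_node, e.toEquiv_node] at ha1
  obtain ⟨rfl, -⟩ := Sigma.mk.inj_iff.1 ha1
  exact ⟨b', rfl⟩

/-- Components stay in one row, so `e.node i` induces an injection on components; a loop of colour
`i` can only come from row `i`. -/
theorem loops_state (e : Sorting n μ) (s t : ∀ i, LinkState (Fin (μ i)) Unit) (i : Fin m) :
    loops (e.state s) (e.state t) i = loops (s i) (t i) () := by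
  let F : Quotient (glue (s i) (t i)) → Quotient (glue (e.state s) (e.state t)) :=
    Quotient.map (e.node i) fun a b h => by
      change glue (e.state s) (e.state t) _ _
      rw [glue_state, rowGlue_node]
      exact h
  have hF : Function.Injective F := by
    rintro ⟨a⟩ ⟨b⟩ h
    have h1 : glue (e.state s) (e.state t) (e.node i a) (e.node i b) := Quotient.exact h
    rw [glue_state, rowGlue_node] at h1
    exact Quotient.sound h1
  rw [loops, loops, ← Set.ncard_image_of_injective _ hF]
  congr 1
  ext C
  constructor
  · intro hC
    obtain ⟨a, rfl⟩ := Quotient.exists_rep C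
    obtain ⟨j, a, rfl⟩ := e.exists_node a
    obtain rfl : j = i := by simpa using (hC _ rfl).1
    refine ⟨Quotient.mk _ a, fun b hb => ⟨rfl, ?_⟩, rfl⟩
    have h1 := (hC (e.node j b) (congrArg F hb)).2
    simpa only [e.state_mate_node, ne_eq, e.node_inj] using h1
  · rintro ⟨D, hD, rfl⟩ b hb
    obtain ⟨a, rfl⟩ := Quotient.exists_rep D
    have h1 : glue (e.state s) (e.state t) b (e.node i a) := Quotient.exact hb
    rw [glue_state] at h1
    obtain ⟨b, rfl⟩ := rowGlue_node_left e s t ((rowGlue e s t).symm h1)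
    rw [rowGlue_node] at h1
    have h2 := (hD b (Quotient.sound h1)).2
    refine ⟨e.state_colour_node s i b, ?_⟩
    simpa only [e.state_mate_node, ne_eq, e.node_inj] using h2

/-- The defect condition holds exactly when it holds in every row, so one failing row kills both
sides; otherwise the loops are counted row by row. -/
theorem pairing_state (e : Sorting n μ) (s t : ∀ i, LinkState (Fin (μ i)) Unit) (δ : Fin m → ℂ) :
    pairing δ (e.state s) (e.state t) = ∏ i, pairing (fun _ => δ i) (s i) (t i) := by
  classical
  have key : (∀ a, (e.state s).mate a = a →
      ∃ b, (e.state t).mate b = b ∧ (glue (e.state s) (e.state t)) a b) ↔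
      ∀ i a, (s i).mate a = a → ∃ b, (t i).mate b = b ∧ (glue (s i) (t i)) a b := by
    rw [glue_state]
    constructor
    · intro h i a ha
      obtain ⟨b, hb, hab⟩ := h (e.node i a) (by rw [e.state_mate_node, ha])
      obtain ⟨b, rfl⟩ := rowGlue_node_left e s t hab
      exact ⟨b, by simpa only [e.state_mate_node, e.node_inj] using hb, (rowGlue_node e s t).1 hab⟩
    · intro h a ha
      obtain ⟨i, a, rfl⟩ := e.exists_node a
      rw [e.state_mate_node, e.node_inj] at ha
      obtain ⟨b, hb, hab⟩ := h i a ha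
      exact ⟨e.node i b, by rw [e.state_mate_node, hb], (rowGlue_node e s t).2 hab⟩
  unfold pairing
  rw [key]
  by_cases h : ∀ i a, (s i).mate a = a → ∃ b, (t i).mate b = b ∧ (glue (s i) (t i)) a b
  · rw [if_pos ⟨rfl, h⟩]
    refine Finset.prod_congr rfl fun i _ => ?_
    rw [if_pos ⟨funext fun _ => rfl, h i⟩, loops_state]
    simp
  · rw [if_neg fun h' => h h'.2]
    obtain ⟨i, hi⟩ := not_forall.1 h
    refine (Finset.prod_eq_zero (Finset.mem_univ i) ?_).symm
    rw [if_neg fun h' => hi h'.2]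

end Pairing

/-! ### Action of the permutation diagrams -/

section Permutation

variable {n m : ℕ}

theorem top_injective : Function.Injective (top : Fin n → Node n) := fun _ _ h =>
  Sum.inl.inj h

theorem top_lt_top {i j : Fin n} : top i < top j ↔ i < j := Sum.Lex.inl_lt_inl_iff

theorem bot_lt_bot {i j : Fin n} : bot i < bot j ↔ j < i := Sum.Lex.inr_lt_inr_iff

theorem top_lt_bot (i j : Fin n) : top i < bot j := Sum.Lex.inl_lt_inr _ _

theorem not_bot_lt_top (i j : Fin n) : ¬ bot i < top j := Sum.Lex.not_inr_lt_inl

theorem node_cases (a : Node n) : (∃ i, a = top i) ∨ ∃ i, a = bot i := by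
  rcases a with i | i
  exacts [Or.inl ⟨i, rfl⟩, Or.inr ⟨OrderDual.ofDual i, rfl⟩]

theorem top_ne_bot (i j : Fin n) : top i ≠ bot j := (top_lt_bot i j).ne

/-- The bijection from the top row to the bottom row given by a permutation diagram. -/
theorem Diagram.IsPermutation.exists_equiv {d : Diagram n m} (hd : d.IsPermutation) :
    ∃ f : Fin n ≃ Fin n, (∀ i, d.1.mate (top i) = bot (f i)) ∧
      ∀ i, d.1.mate (bot (f i)) = top i := by
  choose f hf using hd
  have h2 : ∀ i, d.1.mate (bot (f i)) = top i := fun i => by rw [← hf, d.1.mate_mate]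
  have hinj : Function.Injective f := fun a b hab => by
    have := h2 a
    rw [hab, h2] at this
    exact (top_injective this).symm
  exact ⟨Equiv.ofBijective f ⟨hinj, Finite.surjective_of_injective hinj⟩, hf, h2⟩

/-- The node of the bottom row to which a node is joined. -/
def foot (f : Fin n → Fin n) (a : Node n) : Fin n :=
  Sum.elim f OrderDual.ofDual (ofLex a)

/-- Contracting every edge of `d` to its bottom end leaves only the arcs of `x`. As `x.mate` is an
involution, "equal or partners" is already an equivalence relation. -/
theorem stack_iff {d : Diagram n m} {f : Fin n ≃ Fin n} (h1 : ∀ i, d.1.mate (top i) = bot (f i))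
    (h2 : ∀ i, d.1.mate (bot (f i)) = top i) (x : LinkState (Fin n) (Fin m)) (i j : Fin n) :
    stack d x (top i) (top j) ↔ f j = f i ∨ f j = x.mate (f i) := by
  constructor
  · let r : Setoid (Node n) :=
      { r := fun a b => foot f b = foot f a ∨ foot f b = x.mate (foot f a)
        iseqv :=
          { refl := fun _ => Or.inl rfl
            symm := by
              rintro a b (h | h)
              · exact Or.inl h.symm
              · exact Or.inr (by rw [h, x.mate_mate])
            trans := by
              rintro a b c (h | h) (h' | h')
              · exact Or.inl (h'.trans h)
              · exact Or.inr (by rw [h', h])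
              · exact Or.inr (by rw [h', h])
              · exact Or.inl (by rw [h', h, x.mate_mate]) } }
    have hle : stack d x ≤ r := by
      refine Setoid.eqvGen_le ?_
      rintro a b (rfl | ⟨k, rfl, rfl⟩)
      · left
        rcases node_cases a with ⟨i, rfl⟩ | ⟨i, rfl⟩
        · rw [h1]
          rfl
        · obtain ⟨i, rfl⟩ := f.surjective i
          rw [h2]
          rfl
      · exact Or.inr rfl
    exact fun h => hle h
  · have hd : ∀ a, stack d x a (d.1.mate a) := fun a => Relation.EqvGen.rel _ _ (Or.inl rfl)
    have hx : ∀ k, stack d x (bot k) (bot (x.mate k)) := fun k =>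
      Relation.EqvGen.rel _ _ (Or.inr ⟨k, rfl, rfl⟩)
    rintro (h | h)
    · rw [f.injective h]
    · have e1 := hd (top i)
      have e2 := hx (f i)
      have e3 := hd (bot (f j))
      rw [h1] at e1
      rw [h2] at e3
      rw [h] at e3
      exact (stack d x).trans e1 ((stack d x).trans e2 e3)

/-- Every bottom node is joined to a top node, so every component meets the top row. -/
theorem stackLoops_eq_zero {d : Diagram n m} (hd : d.IsPermutation)
    (x : LinkState (Fin n) (Fin m)) (i : Fin m) : stackLoops d x i = 0 := by
  obtain ⟨f, h1, h2⟩ := hd.exists_equiv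
  refine (congrArg Set.ncard (Set.eq_empty_of_forall_notMem ?_)).trans (Set.ncard_empty _)
  intro C (hC : ∀ a, _)
  obtain ⟨a, rfl⟩ := Quotient.exists_rep C
  have key : ∃ j, stack d x a (top j) := by
    rcases node_cases a with ⟨j, rfl⟩ | ⟨j, rfl⟩
    · exact ⟨j, (stack d x).refl _⟩
    · obtain ⟨j, rfl⟩ := f.surjective j
      exact ⟨j, by rw [← h2]; exact Relation.EqvGen.rel _ _ (Or.inl rfl)⟩
  obtain ⟨j, hj⟩ := key
  obtain ⟨-, k, hk, -⟩ := hC (top j) (Quotient.sound ((stack d x).symm hj))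
  exact top_ne_bot _ _ hk

/-- A permutation diagram moves the parts of each colour without changing their order. -/
theorem isComposite_iff {d : Diagram n m} {f : Fin n ≃ Fin n}
    (h1 : ∀ i, d.1.mate (top i) = bot (f i)) (h2 : ∀ i, d.1.mate (bot (f i)) = top i)
    (x y : LinkState (Fin n) (Fin m)) :
    IsComposite d x y ↔ (∀ k, d.1.colour (bot k) = x.colour k) ∧
      (∀ i, y.colour i = x.colour (f i)) ∧ ∀ i, f (y.mate i) = x.mate (f i) := by
  have hcol : ∀ i, d.1.colour (top i) = d.1.colour (bot (f i)) := fun i => by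
    rw [← h1, d.1.colour_mate]
  unfold IsComposite
  simp only [stack_iff h1 h2, EmbeddingLike.apply_eq_iff_eq]
  constructor
  · rintro ⟨a1, a2, a3⟩
    refine ⟨a1, fun i => by rw [a2, hcol, a1], fun i => ?_⟩
    rcases (a3 i (y.mate i)).2 (Or.inr rfl) with h | h
    · obtain ⟨j, hj⟩ := f.surjective (x.mate (f i))
      rcases (a3 i j).1 (Or.inr hj) with h' | h'
      · rw [h, ← hj, h']
      · rw [← h', hj]
    · exact h
  · rintro ⟨a1, a2, a3⟩
    refine ⟨a1, fun i => by rw [a2, hcol, a1], fun i j => ?_⟩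
    rw [← a3, f.apply_eq_iff_eq]

theorem isComposite_unique {d : Diagram n m} (hd : d.IsPermutation)
    {x y y' : LinkState (Fin n) (Fin m)} (h : IsComposite d x y) (h' : IsComposite d x y') :
    y = y' := by
  obtain ⟨f, h1, h2⟩ := hd.exists_equiv
  rw [isComposite_iff h1 h2] at h h'
  ext i
  · rw [h.2.1, h'.2.1]
  · exact congrArg _ (f.injective ((h.2.2 i).trans (h'.2.2 i).symm))

/-- Uniqueness of the composite makes the choice in `act` harmless, and the absence of loops makes
the scalar 1. -/
theorem act_single {wt : Fin m → ℕ} (δ : Fin m → ℂ) {d : Diagram n m} (hd : d.IsPermutation)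
    {x y : HalfDiagram n wt} (h : IsComposite d x.1 y.1) (r : ℂ) :
    act δ d (Finsupp.single x r) = Finsupp.single y r := by
  have hex : ∃ y : HalfDiagram n wt, IsComposite d x.1 y.1 := ⟨y, h⟩
  have he : hex.choose = y := Subtype.ext (isComposite_unique hd hex.choose_spec h)
  rw [act, Finsupp.linearCombination_single, dif_pos hex, he]
  simp [stackLoops_eq_zero hd]

theorem act_single_eq_zero {wt : Fin m → ℕ} (δ : Fin m → ℂ) {d : Diagram n m}
    {x : HalfDiagram n wt} (h : ¬ ∀ k, d.1.colour (bot k) = x.1.colour k) (r : ℂ) :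
    act δ d (Finsupp.single x r) = 0 := by
  rw [act, Finsupp.linearCombination_single, dif_neg, smul_zero]
  rintro ⟨y, hy⟩
  exact h hy.1

/-- The order on `Node n` runs through the bottom row from right to left, so `noncrossing` excludes
precisely an order reversal between the rows. -/
theorem Diagram.IsPermutation.monotone {d : Diagram n m} {f : Fin n ≃ Fin n}
    (h1 : ∀ i, d.1.mate (top i) = bot (f i)) {i j : Fin n}
    (hc : d.1.colour (top i) = d.1.colour (top j)) (hij : i < j) : f i < f j := by
  have h := d.1.noncrossing (top i) (top j) hc
  rw [h1, h1, top_lt_top, bot_lt_bot] at h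
  by_contra hlt
  refine h ⟨hij, top_lt_bot _ _, lt_of_le_of_ne (not_lt.1 hlt) ?_⟩
  simpa using hij.ne'

variable {μ : Fin m → ℕ}

/-- The arrangement of the top row that a permutation diagram makes from an arrangement of the
bottom row. -/
theorem Diagram.IsPermutation.exists_sorting {d : Diagram n m} (hd : d.IsPermutation)
    (b : Sorting n μ) (hb : ∀ k, d.1.colour (bot k) = (b.toEquiv k).1) :
    ∃ e : Sorting n μ, ∀ s, IsComposite d (b.state s) (e.state s) := by
  obtain ⟨f, h1, h2⟩ := hd.exists_equiv
  have hcol : ∀ i, d.1.colour (top i) = (b.toEquiv (f i)).1 := fun i => by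
    rw [← hb, ← h1, d.1.colour_mate]
  have hmono : ∀ i (a a' : Fin (μ i)), a < a' → f.symm (b.node i a) < f.symm (b.node i a') := by
    intro i a a' haa
    by_contra hlt
    have hne : f.symm (b.node i a') ≠ f.symm (b.node i a) := by
      simpa [b.node_inj] using haa.ne'
    have h := Diagram.IsPermutation.monotone h1 (i := f.symm (b.node i a'))
      (j := f.symm (b.node i a)) (by simp [hcol]) (lt_of_le_of_ne (not_lt.1 hlt) hne)
    rw [f.apply_symm_apply, f.apply_symm_apply, b.node_lt] at h
    exact lt_asymm h haa
  -- The new arrangement is the old one pulled back along `f`; `hmono` says that each row keeps its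
  -- order.
  refine ⟨⟨f.trans b.toEquiv, fun i a a' => ?_⟩, fun s => ?_⟩
  · exact (show StrictMono fun a => f.symm (b.node i a) from fun a a' => hmono i a a').lt_iff_lt
  · rw [isComposite_iff h1 h2]
    refine ⟨hb, fun i => rfl, fun i => ?_⟩
    simp [Sorting.state]

/-- The permutation diagram that joins two arrangements of the nodes. -/
def transition (e b : Sorting n μ) : Diagram n m :=
  ⟨{  colour := fun a => Sum.elim (fun i => (e.toEquiv i).1)
        (fun i => (b.toEquiv (OrderDual.ofDual i)).1) (ofLex a)
      mate := fun a => Sum.elim (fun i => bot (b.toEquiv.symm (e.toEquiv i)))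
        (fun i => top (e.toEquiv.symm (b.toEquiv (OrderDual.ofDual i)))) (ofLex a)
      mate_mate := fun a => by
        rcases node_cases a with ⟨i, rfl⟩ | ⟨i, rfl⟩ <;> simp [top, bot, Sum.inlₗ, Sum.inrₗ]
      colour_mate := fun a => by
        rcases node_cases a with ⟨i, rfl⟩ | ⟨i, rfl⟩ <;> simp [top, bot, Sum.inlₗ, Sum.inrₗ]
      -- `mate` swaps top and bottom, and the top precedes the bottom, so only two top nodes could
      -- start a crossing. In one row their edges keep the order, whereas a crossing would reverse
      -- it.
      noncrossing := fun a a' => by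
        rcases node_cases a with ⟨i, rfl⟩ | ⟨i, rfl⟩
        · rcases node_cases a' with ⟨j, rfl⟩ | ⟨j, rfl⟩
          · obtain ⟨k, i, rfl⟩ := e.exists_node i
            obtain ⟨l, j, rfl⟩ := e.exists_node j
            change (e.toEquiv _).1 = (e.toEquiv _).1 → ¬ (_ ∧ _ ∧
              bot (b.toEquiv.symm (e.toEquiv _)) < bot (b.toEquiv.symm (e.toEquiv _)))
            rw [e.toEquiv_node, e.toEquiv_node]
            rintro rfl
            rw [top_lt_top, bot_lt_bot, e.node_lt, b.lt_iff]
            exact fun h => lt_asymm h.1 h.2.2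
          · exact fun _ h => not_bot_lt_top _ _ h.2.2
        · exact fun _ h => not_bot_lt_top _ _ (h.1.trans h.2.1)
      exposed := fun a a' _ h => by
        rcases node_cases a' with ⟨j, rfl⟩ | ⟨j, rfl⟩
        · exact absurd h.symm (top_ne_bot _ _)
        · exact absurd h (top_ne_bot _ _) },
    fun a => by
      rcases node_cases a with ⟨j, rfl⟩ | ⟨j, rfl⟩
      · exact (top_ne_bot _ _).symm
      · exact top_ne_bot _ _⟩

theorem transition_isPermutation (e b : Sorting n μ) : (transition e b).IsPermutation :=
  fun _ => ⟨_, rfl⟩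

theorem transition_isComposite (e b : Sorting n μ) (s : ∀ i, LinkState (Fin (μ i)) Unit) :
    IsComposite (transition e b) (b.state s) (e.state s) := by
  rw [isComposite_iff (f := e.toEquiv.trans b.toEquiv.symm) (fun _ => rfl)]
  · exact ⟨fun _ => rfl, fun i => by simp [Sorting.state], fun i => by simp [Sorting.state]⟩
  · intro i
    change top _ = top i
    simp

end Permutation

open scoped TensorProduct

/-! ### The kernel of a tensor product of matrices -/

section TensorForm

/-- A linear map between vector spaces has a generalised inverse. -/
theorem exists_apply_sub_mem_ker {V W : Type*} [AddCommGroup V] [Module ℂ V] [AddCommGroup W]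
    [Module ℂ W] (g : V →ₗ[ℂ] W) : ∃ h : W →ₗ[ℂ] V, ∀ v, v - h (g v) ∈ LinearMap.ker g := by
  -- The inverse is a projection `h0` onto the range of `g` followed by a section `k` of `g` over
  -- its range.
  obtain ⟨h0, hh0⟩ := (LinearMap.range g).subtype.exists_leftInverse_of_injective
    (Submodule.ker_subtype _)
  obtain ⟨k, hk⟩ := g.rangeRestrict.exists_rightInverse_of_surjective g.range_rangeRestrict
  refine ⟨k ∘ₗ h0, fun v => ?_⟩
  have e1 : h0 (g v) = g.rangeRestrict v := LinearMap.congr_fun hh0 (g.rangeRestrict v)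
  have e2 : g.rangeRestrict (k (g.rangeRestrict v)) = g.rangeRestrict v :=
    LinearMap.congr_fun hk _
  rw [LinearMap.mem_ker, LinearMap.comp_apply, e1, map_sub, sub_eq_zero]
  exact (congrArg Subtype.val e2).symm

/-- The tensors with the `i`-th factor in `R i`. -/
def factorRange {m : ℕ} {V : Fin m → Type} [∀ i, AddCommGroup (V i)] [∀ i, Module ℂ (V i)]
    (R : ∀ i, Submodule ℂ (V i)) (i : Fin m) : Submodule ℂ (⨂[ℂ] i, V i) :=
  LinearMap.range (PiTensorProduct.map fun j => (if j = i then R j else ⊤ :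
    Submodule ℂ (V j)).subtype)

variable {m : ℕ}

theorem factorRange_eq_span {V : Fin m → Type} [∀ i, AddCommGroup (V i)] [∀ i, Module ℂ (V i)]
    (R : ∀ i, Submodule ℂ (V i)) (i : Fin m) : factorRange R i =
      Submodule.span ℂ (PiTensorProduct.tprod ℂ '' {w | w i ∈ R i}) := by
  rw [factorRange, PiTensorProduct.map_range_eq_span_tprod]
  congr 1
  ext t
  constructor
  · rintro ⟨w, rfl⟩
    refine ⟨fun j => w j, ?_, rfl⟩
    have hle : (if i = i then R i else ⊤) ≤ R i := (if_pos rfl).le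
    exact hle (w i).2
  · rintro ⟨w, hw, rfl⟩
    refine ⟨fun j => ⟨w j, ?_⟩, rfl⟩
    split_ifs with h
    · subst h
      exact hw
    · trivial

/-- Expand `w = w' + (w - w')` multilinearly: every term except that of `w'` alone has some factor
`w i - w' i`, which lies in `R i`. -/
theorem exists_tprod_eq_add {V : Fin m → Type} [∀ i, AddCommGroup (V i)] [∀ i, Module ℂ (V i)]
    (R : ∀ i, Submodule ℂ (V i)) (w w' : ∀ i, V i) (h : ∀ i, w i - w' i ∈ R i) :
    ∃ z ∈ ⨆ i, factorRange R i,
      PiTensorProduct.tprod ℂ w = PiTensorProduct.tprod ℂ w' + z := by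
  classical
  have e : w = w' + (w - w') := by abel
  have e' : PiTensorProduct.tprod ℂ w = PiTensorProduct.tprod ℂ w' +
      ∑ A ∈ Finset.univ.erase Finset.univ,
        PiTensorProduct.tprod ℂ (A.piecewise w' (w - w')) := by
    conv_lhs => rw [e, MultilinearMap.map_add_univ,
      ← Finset.add_sum_erase _ _ (Finset.mem_univ Finset.univ), Finset.piecewise_univ]
  refine ⟨_, ?_, e'⟩
  refine Submodule.sum_mem _ fun A hA => ?_
  obtain ⟨i, hi⟩ : ∃ i, i ∉ A := by
    by_contra! hall
    exact (Finset.mem_erase.1 hA).1 (Finset.eq_univ_of_forall hall)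
  refine Submodule.mem_iSup_of_mem i ?_
  rw [factorRange_eq_span]
  refine Submodule.subset_span ⟨_, ?_, rfl⟩
  simpa [hi] using h i

variable {S : Fin m → Type} [∀ i, Fintype (S i)] (G : ∀ i, S i → S i → ℂ)

/-- The kernel of the tensor product of the matrices `G i`. -/
def productRadical : Submodule ℂ ((∀ i, S i) → ℂ) where
  carrier := {w | ∀ t : ∀ i, S i, ∑ s, w s * ∏ i, G i (s i) (t i) = 0}
  add_mem' := fun {a b} ha hb t => by
    simp [add_mul, Finset.sum_add_distrib, ha t, hb t]
  zero_mem' := fun t => by simp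
  smul_mem' := fun c x hx t => by
    simp [mul_assoc, ← Finset.mul_sum, hx t]

theorem mem_productRadical {w : (∀ i, S i) → ℂ} :
    w ∈ productRadical G ↔ ∀ t : ∀ i, S i, ∑ s, w s * ∏ i, G i (s i) (t i) = 0 := Iff.rfl

/-- The tensor with given coordinates. -/
def toTensor (w : (∀ i, S i) → ℂ) : ⨂[ℂ] i, (S i →₀ ℂ) :=
  ∑ s, w s • PiTensorProduct.tprod ℂ fun i => Finsupp.single (s i) 1

/-- The linear map with matrix `g`. -/
def matrixMap {T : Type} [Fintype T] (g : T → T → ℂ) : (T →₀ ℂ) →ₗ[ℂ] (T → ℂ) :=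
  Finsupp.linearCombination ℂ g

/-- With `h i` a generalised inverse of `G i`, each `h i ∘ G i` is the identity modulo `ker (G i)`,
so applying their tensor product changes `toTensor w` only by an element of the right-hand side.
That tensor product passes through `⨂ G i`, which kills `toTensor w`. -/
theorem toTensor_mem {w : (∀ i, S i) → ℂ} (hw : w ∈ productRadical G) :
    toTensor w ∈ ⨆ i, factorRange (fun i => LinearMap.ker (matrixMap (G i))) i := by
  classical
  choose h hh using fun i => exists_apply_sub_mem_ker (matrixMap (G i))
  -- Expanding in the standard basis exhibits the coordinates of `w` under `⨂ G i`, all zero by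
  -- `hw`.
  have key : ∑ s, w s • PiTensorProduct.tprod ℂ
      (fun i => h i (matrixMap (G i) (Finsupp.single (s i) 1))) = 0 := by
    have e : ∀ s : ∀ i, S i, PiTensorProduct.tprod ℂ
        (fun i => h i (matrixMap (G i) (Finsupp.single (s i) 1))) =
        ∑ t : ∀ i, S i, (∏ i, G i (s i) (t i)) •
          PiTensorProduct.tprod ℂ fun i => h i (Pi.single (t i) 1) := by
      intro s
      have e1 : ∀ i, h i (matrixMap (G i) (Finsupp.single (s i) 1)) =
          ∑ t, G i (s i) t • h i (Pi.single t 1) := by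
        intro i
        rw [matrixMap, Finsupp.linearCombination_single, one_smul]
        conv_lhs => rw [pi_eq_sum_univ' (G i (s i)), map_sum]
        refine Finset.sum_congr rfl fun t _ => ?_
        rw [← map_smul]
      simp only [e1]
      rw [MultilinearMap.map_sum]
      simp only [MultilinearMap.map_smul_univ]
    simp only [e, Finset.smul_sum, smul_smul]
    rw [Finset.sum_comm]
    simp only [← Finset.sum_smul, (mem_productRadical G).1 hw, zero_smul, Finset.sum_const_zero]
  choose z hz e using fun s : ∀ i, S i => exists_tprod_eq_add
    (fun i => LinearMap.ker (matrixMap (G i))) (fun i => Finsupp.single (s i) 1) _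
    fun i => hh i (Finsupp.single (s i) 1)
  have e' : toTensor w = ∑ s, w s • z s := by
    rw [toTensor]
    simp only [e, smul_add, Finset.sum_add_distrib]
    rw [key, zero_add]
  rw [e']
  exact Submodule.sum_mem _ fun s _ => Submodule.smul_mem _ _ (hz s)

/-- The sum over tuples factors into a product of sums, and the `i`-th of these is a coordinate of
`matrixMap (G i) (w i) = 0`. -/
theorem prod_mem_productRadical {w : ∀ i, S i →₀ ℂ} {i : Fin m}
    (hw : w i ∈ LinearMap.ker (matrixMap (G i))) :
    (fun s => ∏ j, w j (s j)) ∈ productRadical G := by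
  classical
  rw [mem_productRadical]
  intro t
  simp only [← Finset.prod_mul_distrib]
  rw [← Fintype.piFinset_univ, ← Finset.prod_univ_sum (fun _ => Finset.univ)
    fun j a => w j a * G j a (t j)]
  refine Finset.prod_eq_zero (Finset.mem_univ i) ?_
  have := congrFun hw (t i)
  rw [matrixMap, Finsupp.linearCombination_apply, Finsupp.sum_fintype _ _ (by simp)] at this
  simpa using this

end TensorForm

/-! ### Radicals as kernels of Gram matrices -/

section Forms

variable {ι κ : Type} [LinearOrder ι] [Fintype κ] {S : Type} [Fintype S]

theorem form_single (toState : S → LinkState ι κ) (δ : κ → ℂ) (x : S →₀ ℂ) (t : S) :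
    form toState δ x (Finsupp.single t 1) =
      ∑ s, x s * pairing δ (toState s) (toState t) := by
  rw [form, Finsupp.linearCombination_apply, Finsupp.sum_fintype _ _ (by simp)]
  simp

theorem mem_formRadical_form (toState : S → LinkState ι κ) (δ : κ → ℂ) (x : S →₀ ℂ) :
    x ∈ formRadical (form toState δ) ↔
      ∀ t, ∑ s, x s * pairing δ (toState s) (toState t) = 0 := by
  constructor
  · intro h t
    rw [← form_single]
    exact h _
  · intro h y
    have : form toState δ x = 0 := by
      refine Finsupp.lhom_ext' fun t => LinearMap.ext_ring ?_
      simpa [form_single] using h t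
    rw [this, LinearMap.zero_apply]

/-- The Gram matrix of the form on `V_{n,p}`. -/
def tlGram (n p : ℕ) (δ : ℂ) (s t : TLState n p) : ℂ := pairing (fun _ => δ) s.1 t.1

theorem tlRadical_eq_ker (n p : ℕ) (δ : ℂ) :
    tlRadical n p δ = LinearMap.ker (matrixMap (tlGram n p δ)) := by
  ext x
  rw [tlRadical, mem_formRadical_form, LinearMap.mem_ker, matrixMap,
    Finsupp.linearCombination_apply, Finsupp.sum_fintype _ _ (by simp), funext_iff]
  simp [tlGram]

end Forms

/-! ### Decomposition of the cell module by colourings -/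

section Sectors

variable {n m v : ℕ} {wt : Fin m → ℕ} {u : Gam v m}

instance : Fintype (HalfDiagram n wt) := Fintype.ofFinite _

/-- The link states `s i` drawn on the nodes of row `i` in colour `i`, as a half-diagram. -/
def Sorting.half (e : Sorting n fun i => wt i + 2 * u.1 i)
    (s : ∀ i, TLState (wt i + 2 * u.1 i) (u.1 i)) : HalfDiagram n wt :=
  ⟨e.state fun i => (s i).1, fun i => by
    rw [e.state_defects]
    have h1 := arcs_defects (s i).1
    rw [(s i).2] at h1
    omega⟩

theorem Sorting.half_injective (e : Sorting n fun i => wt i + 2 * u.1 i) :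
    Function.Injective e.half := fun s t h => by
  have := e.state_injective (congrArg Subtype.val h)
  funext i
  exact Subtype.ext (congrFun this i)

theorem Sorting.exists_half (e : Sorting n fun i => wt i + 2 * u.1 i) (x : HalfDiagram n wt)
    (hx : ∀ a, x.1.colour a = (e.toEquiv a).1) : ∃ s, x = e.half s := by
  obtain ⟨s, hs⟩ := e.exists_state x.1 hx
  refine ⟨fun i => ⟨s i, ?_⟩, Subtype.ext hs⟩
  have h1 := arcs_defects (s i)
  have h2 := x.2 i
  rw [hs, e.state_defects] at h2
  omega

/-- The Gram matrices of the Temperley-Lieb cell modules in the rows. -/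
abbrev rowGram (δ : Fin m → ℂ) (wt : Fin m → ℕ) (u : Gam v m) (i : Fin m) :=
  tlGram (wt i + 2 * u.1 i) (u.1 i) (δ i)

theorem pairing_half (δ : Fin m → ℂ) (e : Sorting n fun i => wt i + 2 * u.1 i)
    (s t : ∀ i, TLState (wt i + 2 * u.1 i) (u.1 i)) :
    pairing δ (e.half s).1 (e.half t).1 = ∏ i, rowGram δ wt u i (s i) (t i) :=
  pairing_state e _ _ δ

/-- The linear extension of `Sorting.half`. -/
def Sorting.embed (e : Sorting n fun i => wt i + 2 * u.1 i) :
    ((∀ i, TLState (wt i + 2 * u.1 i) (u.1 i)) → ℂ) →ₗ[ℂ] Cell n wt :=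
  Fintype.linearCombination ℂ fun s => Finsupp.single (e.half s) 1

theorem Sorting.embed_apply (e : Sorting n fun i => wt i + 2 * u.1 i)
    (w : (∀ i, TLState (wt i + 2 * u.1 i) (u.1 i)) → ℂ) :
    e.embed w = ∑ s, w s • Finsupp.single (e.half s) 1 := by
  rw [embed, Fintype.linearCombination_apply]

theorem Sorting.embed_half (e : Sorting n fun i => wt i + 2 * u.1 i)
    (w : (∀ i, TLState (wt i + 2 * u.1 i) (u.1 i)) → ℂ) (s) : e.embed w (e.half s) = w s := by
  classical
  rw [embed_apply, Finsupp.finsetSum_apply, Finset.sum_eq_single s]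
  · simp
  · intro t _ hts
    simp [e.half_injective.ne hts]
  · simp

theorem Sorting.embed_injective (e : Sorting n fun i => wt i + 2 * u.1 i) :
    Function.Injective e.embed := fun w w' h => funext fun s => by
  rw [← e.embed_half w, h, e.embed_half]

/-- Half-diagrams of another colouring pair to zero with the image of `e.embed`; those of the same
colouring are of the form `e.half t`, where the pairing factors. -/
theorem Sorting.embed_mem (δ : Fin m → ℂ) (e : Sorting n fun i => wt i + 2 * u.1 i)
    {w : (∀ i, TLState (wt i + 2 * u.1 i) (u.1 i)) → ℂ}
    (hw : w ∈ productRadical (rowGram δ wt u)) : e.embed w ∈ cellRadical n wt δ := by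
  rw [cellRadical, cellForm, mem_formRadical_form]
  intro t
  rw [← form_single, embed_apply, map_sum, LinearMap.sum_apply]
  have h1 : ∀ s, form (fun x : HalfDiagram n wt => x.1) δ (w s • Finsupp.single (e.half s) 1)
      (Finsupp.single t 1) = w s * pairing δ (e.half s).1 t.1 := fun s => by
    rw [map_smul, LinearMap.smul_apply, smul_eq_mul]
    simp [form]
  simp only [h1]
  by_cases ht : ∀ a, t.1.colour a = (e.toEquiv a).1
  · obtain ⟨t, rfl⟩ := e.exists_half t ht
    simp only [pairing_half]
    exact (mem_productRadical _).1 hw t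
  · refine Finset.sum_eq_zero fun s _ => ?_
    rw [pairing, if_neg, mul_zero]
    exact fun h => ht fun a => (congrFun h.1 a).symm

/-- The colourings of the nodes that occur in the half-diagrams, together with the numbers of
arcs of each colour. -/
abbrev Sector (n v : ℕ) (wt : Fin m → ℕ) : Type :=
  Σ u : Gam v m, {c : Fin n → Fin m // ∀ i, Fintype.card {a // c a = i} = wt i + 2 * u.1 i}

/-- The nodes sorted by the colouring of a sector. -/
def Sector.sorting (k : Sector n v wt) : Sorting n fun i => wt i + 2 * k.1.1 i :=
  colourSorting k.2.1 k.2.2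

instance : Finite (Gam v m) :=
  Finite.of_injective
    (fun u i => (⟨u.1 i, Nat.lt_succ_of_le
      ((Finset.single_le_sum (fun _ _ => Nat.zero_le _) (Finset.mem_univ i)).trans u.2.le)⟩ :
      Fin (v + 1)))
    fun _ _ h => Subtype.ext (funext fun i => congrArg Fin.val (congrFun h i))

instance : Fintype (Gam v m) := Fintype.ofFinite _

/-- A half-diagram of a given sector. -/
def sectorHalf (p : Σ k : Sector n v wt, ∀ i, TLState (wt i + 2 * k.1.1 i) (k.1.1 i)) :
    HalfDiagram n wt := p.1.sorting.half p.2

/-- The class sizes `wt i + 2 * u i` determine `u`. -/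
theorem Sector.ext_colour {k k' : Sector n v wt} (h : k.2.1 = k'.2.1) : k = k' := by
  obtain ⟨u, c, hc⟩ := k
  obtain ⟨u', c', hc'⟩ := k'
  obtain rfl : c = c' := h
  obtain rfl : u = u' := Subtype.ext (funext fun i => by
    have h1 := hc i
    have h2 := hc' i
    omega)
  rfl

theorem sectorHalf_bijective (hwt : ∑ i, wt i + 2 * v = n) :
    Function.Bijective (sectorHalf (n := n) (v := v) (wt := wt)) := by
  constructor
  · rintro ⟨k, s⟩ ⟨k', s'⟩ h
    obtain rfl : k = k' := Sector.ext_colour (congrArg (fun x => x.1.colour) h)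
    obtain rfl := k.sorting.half_injective h
    rfl
  · intro x
    -- The rows first get the raw class sizes; counting the arcs in each row then produces `u` and
    -- shows that these sizes are `wt i + 2 * u i`.
    let e : Sorting n fun i => Fintype.card {a // x.1.colour a = i} :=
      colourSorting x.1.colour fun _ => rfl
    obtain ⟨s, hs⟩ := e.exists_state x.1 fun _ => rfl
    have hcard : ∀ i, Fintype.card {a // x.1.colour a = i} = wt i + 2 * (s i).arcs := fun i => by
      have h1 := arcs_defects (s i)
      have h2 := x.2 i
      rw [hs, e.state_defects] at h2
      omega
    have hsum : ∑ i, (s i).arcs = v := by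
      have h1 := Fintype.card_congr (Equiv.sigmaFiberEquiv x.1.colour)
      rw [Fintype.card_sigma, Fintype.card_fin, Finset.sum_congr rfl fun i _ => hcard i,
        Finset.sum_add_distrib, ← Finset.mul_sum] at h1
      omega
    let k : Sector n v wt := ⟨⟨fun i => (s i).arcs, hsum⟩, x.1.colour, hcard⟩
    obtain ⟨t, ht⟩ := k.sorting.exists_half x fun _ => rfl
    exact ⟨⟨k, t⟩, ht.symm⟩

theorem sum_halfDiagram {M : Type*} [AddCommMonoid M] (hwt : ∑ i, wt i + 2 * v = n)
    (f : HalfDiagram n wt → M) :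
    ∑ x, f x = ∑ k : Sector n v wt, ∑ s, f (k.sorting.half s) := by
  rw [← (sectorHalf_bijective hwt).sum_comp f, Fintype.sum_sigma]
  rfl

/-- Distinct sectors have distinct colourings and are therefore orthogonal, so the radical condition
can be tested within each sector. -/
theorem mem_cellRadical_iff (hwt : ∑ i, wt i + 2 * v = n) (δ : Fin m → ℂ) (x : Cell n wt) :
    x ∈ cellRadical n wt δ ↔ ∀ k : Sector n v wt,
      (fun s => x (k.sorting.half s)) ∈ productRadical (rowGram δ wt k.1) := by
  have key : ∀ (k : Sector n v wt) t,
      ∑ y : HalfDiagram n wt, x y * pairing δ y.1 (k.sorting.half t).1 =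
        ∑ s, x (k.sorting.half s) * ∏ i, rowGram δ wt k.1 i (s i) (t i) := by
    intro k t
    rw [sum_halfDiagram hwt, Finset.sum_eq_single k]
    · simp only [pairing_half]
    · intro k' _ hk
      refine Finset.sum_eq_zero fun s _ => ?_
      rw [pairing, if_neg, mul_zero]
      exact fun h => hk (Sector.ext_colour h.1)
    · simp
  rw [cellRadical, cellForm, mem_formRadical_form]
  simp only [mem_productRadical, ← key]
  constructor
  · exact fun h k t => h _
  · intro h t
    obtain ⟨⟨k, t⟩, rfl⟩ := (sectorHalf_bijective hwt).2 t
    exact h k t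

theorem eq_sum_embed (hwt : ∑ i, wt i + 2 * v = n) (x : Cell n wt) :
    x = ∑ k : Sector n v wt, k.sorting.embed fun s => x (k.sorting.half s) := by
  simp only [Sorting.embed_apply]
  rw [← sum_halfDiagram hwt fun y => x y • Finsupp.single y 1]
  conv_lhs => rw [← Finsupp.univ_sum_single x]
  simp

/-- The radical of the cell module is the direct sum of its parts in the sectors. -/
def cellRadicalEquiv (hwt : ∑ i, wt i + 2 * v = n) (δ : Fin m → ℂ) :
    cellRadical n wt δ ≃ₗ[ℂ] ∀ k : Sector n v wt, productRadical (rowGram δ wt k.1) :=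
  LinearEquiv.ofBijective
    { toFun := fun x k => ⟨fun s => x.1 (k.sorting.half s), (mem_cellRadical_iff hwt δ x.1).1 x.2 k⟩
      map_add' := fun _ _ => rfl
      map_smul' := fun _ _ => rfl } (by
    constructor
    · intro x y h
      refine Subtype.ext (Finsupp.ext fun z => ?_)
      obtain ⟨⟨k, s⟩, rfl⟩ := (sectorHalf_bijective hwt).2 z
      exact congrFun (congrArg Subtype.val (congrFun h k)) s
    · intro w
      let F := (Equiv.ofBijective _ (sectorHalf_bijective (wt := wt) hwt)).symm
      have hF : ∀ (k : Sector n v wt) s, F (k.sorting.half s) = ⟨k, s⟩ := fun k s =>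
        (Equiv.ofBijective _ (sectorHalf_bijective (wt := wt) hwt)).symm_apply_apply ⟨k, s⟩
      let x : Cell n wt := Finsupp.equivFunOnFinite.symm fun z => (w (F z).1).1 (F z).2
      have hx : ∀ (k : Sector n v wt) s, x (k.sorting.half s) = (w k).1 s := fun k s => by
        change (w (F _).1).1 (F _).2 = _
        rw [hF]
      refine ⟨⟨x, (mem_cellRadical_iff hwt δ x).2 fun k => ?_⟩, funext fun k => Subtype.ext ?_⟩
      · rw [show (fun s => x (k.sorting.half s)) = (w k).1 from funext (hx k)]
        exact (w k).2
      · exact funext (hx k))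

end Sectors

/-! ### The two parts of the theorem -/

section Main

variable {n m v : ℕ} {wt : Fin m → ℕ}

theorem tensorToCell_tprod (hwt : ∑ i, wt i + 2 * v = n) (u : Gam v m)
    (w : ∀ i, TLCell (wt i + 2 * u.1 i) (u.1 i)) :
    tensorToCell hwt u (PiTensorProduct.tprod ℂ w) =
      (blockSorting (sum_add_two_mul hwt u)).embed fun s => ∏ i, w i (s i) := by
  rw [tensorToCell, PiTensorProduct.lift.tprod, Sorting.embed_apply, sum_apply]
  simp only [MultilinearMap.smulRight_apply, MultilinearMap.compLinearMap_apply,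
    MultilinearMap.mkPiAlgebra_apply, Finsupp.lapply_apply]
  -- `juxt hwt u s` unfolds to `half` of the block arrangement.
  rfl

theorem tensorToCell_toTensor (hwt : ∑ i, wt i + 2 * v = n) (u : Gam v m)
    (w : (∀ i, TLState (wt i + 2 * u.1 i) (u.1 i)) → ℂ) :
    tensorToCell hwt u (toTensor w) = (blockSorting (sum_add_two_mul hwt u)).embed w := by
  classical
  simp only [toTensor, map_sum, map_smul, tensorToCell_tprod]
  simp only [← map_smul, ← map_sum]
  congr 1
  funext t
  rw [Finset.sum_apply, Finset.sum_eq_single t]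
  · simp
  · intro s _ hs
    obtain ⟨i, hi⟩ := Function.ne_iff.1 hs
    rw [Pi.smul_apply, Finset.prod_eq_zero (Finset.mem_univ i), smul_zero]
    rw [Finsupp.single_apply, if_neg hi]
  · simp

/-- The two inclusions are the two halves of the description of the kernel of a tensor product,
transported to the block colouring. -/
theorem iSup_radicalFactor (δ : Fin m → ℂ) (hwt : ∑ i, wt i + 2 * v = n) (u : Gam v m) :
    ⨆ i, radicalFactor δ hwt u i = (productRadical (rowGram δ wt u)).map
      (blockSorting (sum_add_two_mul hwt u)).embed := by
  have h : ∀ i, radicalFactor δ hwt u i =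
      (factorRange (fun j => LinearMap.ker (matrixMap (rowGram δ wt u j))) i).map
        (tensorToCell hwt u) := fun i => by
    simp only [← tlRadical_eq_ker]
    rfl
  apply le_antisymm
  · refine iSup_le fun i => ?_
    rw [h, factorRange_eq_span, Submodule.map_span, Submodule.span_le]
    rintro _ ⟨_, ⟨w, hw, rfl⟩, rfl⟩
    rw [tensorToCell_tprod]
    exact Submodule.mem_map_of_mem (prod_mem_productRadical _ hw)
  · rintro _ ⟨w, hw, rfl⟩
    rw [← tensorToCell_toTensor]
    simp only [h, ← Submodule.map_iSup]
    exact Submodule.mem_map_of_mem (toTensor_mem _ hw)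

theorem act_embed {u : Gam v m} (δ : Fin m → ℂ) {d : Diagram n m} (hd : d.IsPermutation)
    {b e : Sorting n fun i => wt i + 2 * u.1 i}
    (h : ∀ s, IsComposite d (b.state s) (e.state s)) (w) :
    act δ d (b.embed w) = e.embed w := by
  simp only [Sorting.embed_apply, map_sum, map_smul]
  refine Finset.sum_congr rfl fun s _ => ?_
  rw [act_single δ hd (y := e.half s) (h _)]

theorem cellRadical_eq_iSup (δ : Fin m → ℂ) (hwt : ∑ i, wt i + 2 * v = n) :
    cellRadical n wt δ = ⨆ (u : Gam v m) (σ : Diagram n m) (_ : σ.IsPermutation),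
      (⨆ i : Fin m, radicalFactor δ hwt u i).map (act δ σ) := by
  simp only [iSup_radicalFactor]
  apply le_antisymm
  · intro x hx
    rw [eq_sum_embed hwt x]
    refine Submodule.sum_mem _ fun k _ => ?_
    -- The component of `x` in sector `k` is the image, under the transition from the blocks to `k`,
    -- of the vector with the same coordinates in block position.
    let b := blockSorting (sum_add_two_mul hwt k.1)
    refine Submodule.mem_iSup_of_mem k.1 (Submodule.mem_iSup_of_mem (transition k.sorting b)
      (Submodule.mem_iSup_of_mem (transition_isPermutation _ _) ?_))
    rw [← act_embed δ (transition_isPermutation _ _) (transition_isComposite k.sorting b)]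
    exact Submodule.mem_map_of_mem
      (Submodule.mem_map_of_mem ((mem_cellRadical_iff hwt δ x).1 hx k))
  · refine iSup_le fun u => iSup_le fun d => iSup_le fun hd => ?_
    rintro _ ⟨_, ⟨w, hw, rfl⟩, rfl⟩
    let b := blockSorting (sum_add_two_mul hwt u)
    -- If the bottom colours match the blocks, `d` moves the vector to another arrangement, where it
    -- is still in the radical; otherwise `d` kills it.
    by_cases hb : ∀ k, d.1.colour (bot k) = (b.toEquiv k).1
    · obtain ⟨e, he⟩ := hd.exists_sorting b hb
      rw [act_embed δ hd he]
      exact e.embed_mem δ hw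
    · rw [Sorting.embed_apply, map_sum, Finset.sum_eq_zero]
      · exact zero_mem _
      · intro s _
        rw [map_smul, act_single_eq_zero δ hb, smul_zero]

/-- The number of colourings of `n` nodes with `μ i` nodes of each of the two colours `i`. -/
theorem card_colourings (μ : Fin 2 → ℕ) (hμ : ∑ i, μ i = n) :
    Fintype.card {c : Fin n → Fin 2 // ∀ i, Fintype.card {a // c a = i} = μ i} =
      Nat.multinomial Finset.univ μ := by
  have hbin : Nat.multinomial Finset.univ μ = n.choose (μ 0) := by
    rw [Fin.sum_univ_two] at hμ
    rw [← hμ, show μ = ![μ 0, μ 1] from by ext i; fin_cases i <;> rfl, Nat.multinomial_univ_two]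
    rw [Nat.choose_symm_add, Nat.add_choose]
    rfl
  have hcard : ∀ (c : Fin n → Fin 2), Fintype.card {a // c a = 0} +
      Fintype.card {a // c a = 1} = n := fun c => by
    have h1 := Fintype.card_congr (Equiv.sigmaFiberEquiv c)
    rwa [Fintype.card_sigma, Fintype.card_fin, Fin.sum_univ_two] at h1
  have hlen := Fintype.card_finset_len (α := Fin n) (μ 0)
  rw [Fintype.card_fin] at hlen
  rw [hbin, ← hlen]
  -- A two-colouring is determined by its set of nodes of colour 0, an arbitrary subset of size `μ
  -- 0`.
  refine Fintype.card_congr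
    { toFun := fun c => ⟨Finset.univ.filter fun a => c.1 a = 0, ?_⟩
      invFun := fun s => ⟨fun a => if a ∈ s.1 then 0 else 1, ?_⟩
      left_inv := ?_
      right_inv := ?_ }
  · rw [← c.2 0, Fintype.card_subtype]
  · let c : Fin n → Fin 2 := fun a => if a ∈ s.1 then 0 else 1
    change ∀ i, Fintype.card {a // c a = i} = μ i
    have h0 : Fintype.card {a // c a = 0} = μ 0 := by
      rw [Fintype.card_subtype]
      simpa [c] using s.2
    have h := hcard c
    rw [Fin.sum_univ_two] at hμ
    rw [Fin.forall_fin_two]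
    exact ⟨h0, by omega⟩
  · rintro ⟨c, hc⟩
    refine Subtype.ext (funext fun a => ?_)
    simp only [Finset.mem_filter, Finset.mem_univ, true_and]
    split_ifs with h
    · exact h.symm
    · omega
  · rintro ⟨s, hs⟩
    refine Subtype.ext (Finset.ext fun a => ?_)
    simp

/-- Only dimensions need comparing. `embed` is injective, so each sector over `u` contributes the
dimension of the summand for `u`, and the number of these sectors is the multinomial coefficient. -/
theorem nonempty_cellRadical_equiv {wt : Fin 2 → ℕ} (δ : Fin 2 → ℂ)
    (hwt : ∑ i, wt i + 2 * v = n) :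
    Nonempty (cellRadical n wt δ ≃ₗ[ℂ]
      ⨁ (u : Gam v 2) (_ : Fin (Nat.multinomial Finset.univ fun i => wt i + 2 * u.1 i)),
        ↥(radicalFactor δ hwt u 0 ⊔ radicalFactor δ hwt u 1)) := by
  have e (u : Gam v 2) : productRadical (rowGram δ wt u) ≃ₗ[ℂ]
      ↥(radicalFactor δ hwt u 0 ⊔ radicalFactor δ hwt u 1) :=
    (Submodule.equivMapOfInjective _ (Sorting.embed_injective _) _).trans
      (LinearEquiv.ofEq _ _ ((iSup_radicalFactor δ hwt u).symm.trans (by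
        apply le_antisymm
        · exact iSup_le (Fin.forall_fin_two.2 ⟨le_sup_left, le_sup_right⟩)
        · exact sup_le (le_iSup _ 0) (le_iSup _ 1))))
  have : Module.Free ℂ (cellRadical n wt δ) := Module.Free.of_equiv (cellRadicalEquiv hwt δ).symm
  have (u : Gam v 2) : Module.Free ℂ ↥(radicalFactor δ hwt u 0 ⊔ radicalFactor δ hwt u 1) :=
    Module.Free.of_equiv (e u)
  have (u : Gam v 2) : Module.Finite ℂ ↥(radicalFactor δ hwt u 0 ⊔ radicalFactor δ hwt u 1) :=
    Module.Finite.equiv (e u)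
  refine FiniteDimensional.nonempty_linearEquiv_of_finrank_eq ?_
  rw [(cellRadicalEquiv hwt δ).finrank_eq, Module.finrank_pi_fintype, Fintype.sum_sigma,
    Module.finrank_directSum]
  refine Finset.sum_congr rfl fun u _ => ?_
  rw [Module.finrank_directSum, ← (e u).finrank_eq, Finset.sum_const]
  change ∑ _, Module.finrank ℂ (productRadical (rowGram δ wt u)) = _
  rw [Finset.sum_const, Finset.card_univ, Finset.card_univ,
    card_colourings _ (sum_add_two_mul hwt u), Fintype.card_fin]

end Main

end Bubble

end

theorem theorem6 :
    (∀ (n m v : ℕ) (δ : Fin m → ℂ) (wt : Fin m → ℕ) (hwt : ∑ i, wt i + 2 * v = n),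
      Bubble.cellRadical n wt δ =
        ⨆ (u : Bubble.Gam v m) (σ : Bubble.Diagram n m) (_ : σ.IsPermutation),
          (⨆ i : Fin m, Bubble.radicalFactor δ hwt u i).map (Bubble.act δ σ)) ∧
    (∀ (n v : ℕ) (δ : Fin 2 → ℂ) (wt : Fin 2 → ℕ) (hwt : ∑ i, wt i + 2 * v = n),
      Nonempty (Bubble.cellRadical n wt δ ≃ₗ[ℂ]
        ⨁ (u : Bubble.Gam v 2)
          (_ : Fin (Nat.multinomial Finset.univ fun i => wt i + 2 * u.1 i)),
          ↥(Bubble.radicalFactor δ hwt u 0 ⊔ Bubble.radicalFactor δ hwt u 1))) :=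
  ⟨fun _ _ _ δ _ hwt => Bubble.cellRadical_eq_iSup δ hwt,
    fun _ _ δ _ hwt => Bubble.nonempty_cellRadical_equiv δ hwt⟩
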